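/- Let $(M,c,J)$ be a locally conformal Kähler manifold of real dimension $n\ge 4$. Here $L^t_M$ is the line bundle of densities of weight $t$, whose fibre at $x$ consists of the maps $l:\Lambda^n(T_xM)\setminus 0\to\mathbb R$ with $l(\lambda w)=|\lambda|^{-t/n}l(w)$ for real $\lambda\neq0$; for a Riemannian metric $g$, $l_g^t$ is the section of $L^t_M$ equal to $1$ on elements of $g$-length one. The conformal structure is the section $c=g\otimes l_g^2$ of $S^2M\otimes L^2_M$, which depends only on the conformal class of $g$; a metric $g$ belongs to the class (is a gauge) if $c=g\otimes l_g^2$. The complex structure $J$ is compatible with $c$, and near every point the metrics of the class are conformal to Kähler metrics. For $g$ in the class let $\Omega_g(X,Y)=g(JX,Y)$, let the Lee form $\omega_g$ be the $1$-form with $d\Omega_g=\omega_g\wedge\Omega_g$, let $d^{\omega_g}f=df-f\omega_g$, define $\sharp_g$ by $\iota_{\sharp_g\alpha}\Omega_g=\alpha$, and let $\{f_1,f_2\}_g=\Omega_g(\sharp_g d^{\omega_g}f_1,\sharp_g d^{\omega_g}f_2)$ on $C^\infty(M)$. Let $\Omega(X,Y)=c(JX,Y)\in\Gamma(L^2_M)$,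 let $\nabla$ be the canonical Weyl connection, determined on $L^1_M$ by $\nabla l_g=-\tfrac12\omega_g\otimes l_g$ (for any $g$ in the class) and hence on $L^2_M$ by $\nabla l_g^2=-\omega_g\otimes l_g^2$, define $\sharp$ by $\iota_{\sharp\alpha}\Omega=\alpha$ for $L^2_M$-valued $1$-forms $\alpha$, and let $\{s_1,s_2\}=\Omega(\sharp\nabla s_1,\sharp\nabla s_2)$ on $\Gamma(L^2_M)$. Let $G$ be a Lie group with Lie algebra $\mathfrak g$ acting smoothly on $M$ by automorphisms of $(M,c,J)$, i.e. diffeomorphisms $h$ preserving $J$ with $h^*g=e^{\alpha}g$, $\alpha\in C^\infty(M)$, for $g$ in the class (for instance a connected Lie subgroup of the automorphism group); identify $X\in\mathfrak g$ with its fundamental vector field on $M$. A map $\mu:\mathfrak g\to\Gamma(L^2_M)$, $X\mapsto\mu^X$, is a momentum map for the conformal structure if it is linear, $\mu^{[X,Y]}=\{\mu^X,\mu^Y\}$, and $\iota_X\Omega=\nabla\mu^X$ for all $X,Y\in\mathfrak g$. A map $\nu:\mathfrak g\to C^\infty(M)$ is a twisted-Hamiltonian momentum map with respect to $g$ if it is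 linear, $\nu^{[X,Y]}=\{\nu^X,\nu^Y\}_g$, and $\iota_X\Omega_g=d^{\omega_g}\nu^X$ for all $X,Y\in\mathfrak g$. Let $\mu:\mathfrak g\to\Gamma(L^2_M)$ be any map. For every metric $g$ in the conformal class there is a unique map $\mu_g:\mathfrak g\to C^\infty(M)$ with $\mu^X=\mu_g^X\otimes l_g^2$ for all $X\in\mathfrak g$, and $\mu$ is a momentum map for the conformal structure if and only if $\mu_g$ is a twisted-Hamiltonian momentum map with respect to $g$. In particular, $\mu$ is a momentum map for the conformal structure if and only if $\mu_g$ is a twisted-Hamiltonian momentum map for some metric $g$ in the class, equivalently for every one. -/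

import Mathlib

open scoped Manifold ContDiff

noncomputable section

namespace LCK

/-! ### Densities on a vector space -/

section VectorSpace

variable {V : Type*} [AddCommGroup V] [Module ℝ V]

/-- The space `L^t_V` of densities of weight `t` on an `n`-dimensional real vector space `V`:
maps `l : Λⁿ V \ 0 → ℝ` such that `l (a w) = |a| ^ (-t / n) l (w)` for real `a ≠ 0`. -/
def Density (t : ℝ) (V : Type*) [AddCommGroup V] [Module ℝ V] :
    Submodule ℝ ({w : ⋀[ℝ]^(Module.finrank ℝ V) V // w ≠ 0} → ℝ) where
  carrier := {l | ∀ (a : ℝ) (ha : a ≠ 0) (w : {w : ⋀[ℝ]^(Module.finrank ℝ V) V // w ≠ 0}),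
    l ⟨a • w.1, smul_ne_zero ha w.2⟩ = |a| ^ (-t / (Module.finrank ℝ V : ℝ)) * l w}
  add_mem' := by
    intro l l' hl hl' a ha w
    simp only [Pi.add_apply, hl a ha w, hl' a ha w, mul_add]
  zero_mem' := by
    intro a ha w
    simp
  smul_mem' := by
    intro r l hl a ha w
    simp only [Pi.smul_apply, smul_eq_mul, hl a ha w]
    ring

/-- The value of a density at `w ∈ Λⁿ V`, extended by `0` at `w = 0`. -/
def densityEval {t : ℝ} (l : Density t V) (w : ⋀[ℝ]^(Module.finrank ℝ V) V) : ℝ := by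
  classical exact if h : w ≠ 0 then l.1 ⟨w, h⟩ else 0

lemma density_eval_add {t : ℝ} (l l' : Density t V) (w : ⋀[ℝ]^(Module.finrank ℝ V) V) :
    densityEval (l + l') w = densityEval l w + densityEval l' w := by
  by_cases h : w = 0 <;> simp [densityEval, h]

lemma density_eval_smul {t : ℝ} (r : ℝ) (l : Density t V) (w : ⋀[ℝ]^(Module.finrank ℝ V) V) :
    densityEval (r • l) w = r * densityEval l w := by
  by_cases h : w = 0 <;> simp [densityEval, h]

lemma density_eval_zero {t : ℝ} (w : ⋀[ℝ]^(Module.finrank ℝ V) V) :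
    densityEval (0 : Density t V) w = 0 := by
  by_cases h : w = 0 <;> simp [densityEval, h]

/-- The length `|w|_b` of `w ∈ Λⁿ V` with respect to a scalar product `b` on `V`; on decomposable
elements, `|v₁ ∧ ⋯ ∧ vₙ|_b = √(det (b (vᵢ, vⱼ)))`. -/
def extLength (b : V →ₗ[ℝ] V →ₗ[ℝ] ℝ) (w : ⋀[ℝ]^(Module.finrank ℝ V) V) : ℝ :=
  Real.sqrt (exteriorPower.pairingDual ℝ V (Module.finrank ℝ V)
    (exteriorPower.map (Module.finrank ℝ V) b w) w)

lemma extLength_smul (b : V →ₗ[ℝ] V →ₗ[ℝ] ℝ) (a : ℝ) (w : ⋀[ℝ]^(Module.finrank ℝ V) V) :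
    extLength b (a • w) = |a| * extLength b w := by
  unfold extLength
  rw [map_smul, map_smul, map_smul, LinearMap.smul_apply, smul_eq_mul, smul_eq_mul, ← mul_assoc,
    Real.sqrt_mul (mul_self_nonneg a), Real.sqrt_mul_self_eq_abs]

/-- The density `l_b^t` of weight `t` defined by a scalar product `b` on `V`: the one that sends
the elements of length one of `Λⁿ V` to `1`, that is, `l_b^t (w) = |w|_b ^ (-t / n)`. -/
def lengthDensity (b : V →ₗ[ℝ] V →ₗ[ℝ] ℝ) (t : ℝ) : Density t V :=
  ⟨fun w => extLength b w.1 ^ (-t / (Module.finrank ℝ V : ℝ)), by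
    intro a ha w
    show extLength b (a • w.1) ^ _ = _ * extLength b w.1 ^ _
    rw [extLength_smul]
    exact Real.mul_rpow (abs_nonneg a) (Real.sqrt_nonneg _)⟩

/-- The real number `r` such that `s = r l` (meaningful when `l ≠ 0`, as densities of a fixed
weight form a line). -/
def densityRatio {t : ℝ} (s l : Density t V) : ℝ :=
  Classical.epsilon fun r : ℝ => s = r • l

/-- The vector `♯α` defined by `ι_{♯α} Ω = α`, for a non-degenerate two-form `Ω` and a one-form
`α`, both with values in the same line `L`. -/
def sharp {L : Type*} [AddCommGroup L] [Module ℝ L] (Ω : V →ₗ[ℝ] V →ₗ[ℝ] L) (α : V →ₗ[ℝ] L) : V :=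
  Classical.epsilon fun v : V => Ω v = α

end VectorSpace

/-! ### Manifolds, metrics, almost complex structures -/

section Manifold

variable (E : Type*) [NormedAddCommGroup E] [NormedSpace ℝ E]
  (M : Type*) [TopologicalSpace M] [ChartedSpace E M]

/-- Smooth real functions `C^∞(M)`. -/
abbrev SmoothFun : Type _ := C^∞⟮𝓘(ℝ, E), M; ℝ⟯

/-- The fibre at `x` of the density line bundle `L^t_M`. -/
abbrev DensityAt (t : ℝ) {M : Type*} [TopologicalSpace M] [ChartedSpace E M] (x : M) : Type _ :=
  Density t (TangentSpace 𝓘(ℝ, E) x)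

variable [IsManifold 𝓘(ℝ, E) ∞ M]

/-- Smooth Riemannian metrics on `M`. -/
abbrev Metric : Type _ :=
  Bundle.ContMDiffRiemannianMetric 𝓘(ℝ, E) ∞ E (fun x : M => TangentSpace 𝓘(ℝ, E) x)

/-- Almost complex structures on `M`. -/
structure AlmostComplexStructure where
  /-- The endomorphism of each tangent space. -/
  toFun : ∀ x : M, TangentSpace 𝓘(ℝ, E) x →L[ℝ] TangentSpace 𝓘(ℝ, E) x
  sq : ∀ (x : M) (v : TangentSpace 𝓘(ℝ, E) x), toFun x (toFun x v) = -v
  contMDiff : ContMDiff 𝓘(ℝ, E) (𝓘(ℝ, E).prod 𝓘(ℝ, E →L[ℝ] E)) ∞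
    (fun x => Bundle.TotalSpace.mk' (E →L[ℝ] E)
      (E := fun x : M => TangentSpace 𝓘(ℝ, E) x →L[ℝ] TangentSpace 𝓘(ℝ, E) x) x (toFun x))

/-- The space `Γ(L^t_M)` of smooth sections of the density bundle `L^t_M`. A section `s` is smooth
if `s (X₁ ∧ ⋯ ∧ Xₙ)` is a smooth function on `U` for every smooth frame `X₁, …, Xₙ` of the tangent
bundle over an open set `U`. -/
def DensitySection (t : ℝ) : Submodule ℝ (∀ x : M, DensityAt E t x) where
  carrier := {s | ∀ (U : Set M) (X : Fin (Module.finrank ℝ E) → ∀ x : M, TangentSpace 𝓘(ℝ, E) x),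
    IsOpen U →
    (∀ i, ContMDiffOn 𝓘(ℝ, E) 𝓘(ℝ, E).tangent ∞
      (fun x => (Bundle.TotalSpace.mk' E x (X i x) : TangentBundle 𝓘(ℝ, E) M)) U) →
    (∀ x ∈ U, LinearIndependent ℝ fun i => X i x) →
    ContMDiffOn 𝓘(ℝ, E) 𝓘(ℝ, ℝ) ∞
      (fun x => densityEval (s x)
        (exteriorPower.ιMulti ℝ (Module.finrank ℝ (TangentSpace 𝓘(ℝ, E) x)) fun i => X i x)) U}
  add_mem' := by
    intro s s' hs hs' U X hU hX hX'
    simp only [Pi.add_apply, density_eval_add]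
    exact (hs U X hU hX hX').add (hs' U X hU hX hX')
  zero_mem' := by
    intro U X hU hX hX'
    simp only [Pi.zero_apply, density_eval_zero]
    exact contMDiffOn_const
  smul_mem' := by
    intro r s hs U X hU hX hX'
    simp only [Pi.smul_apply, density_eval_smul]
    exact contMDiffOn_const.mul (hs U X hU hX hX')

variable {E M}

/-- The scalar product `g_x` as a bilinear form. -/
def Metric.form (g : Metric E M) (x : M) :
    TangentSpace 𝓘(ℝ, E) x →ₗ[ℝ] TangentSpace 𝓘(ℝ, E) x →ₗ[ℝ] ℝ :=
  LinearMap.mk₂ ℝ (fun u v => g.inner x u v) (by intros; simp) (by intros; simp)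
    (by intros; simp) (by intros; simp)

/-- The section `l_g^t` of `L^t_M` defined by a metric `g`. -/
def Metric.scale (g : Metric E M) (t : ℝ) (x : M) : DensityAt E t x :=
  lengthDensity (g.form x) t

/-- `J` is integrable: its Nijenhuis tensor vanishes. -/
def AlmostComplexStructure.IsIntegrable (J : AlmostComplexStructure E M) : Prop :=
  ∀ X Y : ∀ x : M, TangentSpace 𝓘(ℝ, E) x,
    ContMDiff 𝓘(ℝ, E) 𝓘(ℝ, E).tangent ∞
      (fun x => (Bundle.TotalSpace.mk' E x (X x) : TangentBundle 𝓘(ℝ, E) M)) →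
    ContMDiff 𝓘(ℝ, E) 𝓘(ℝ, E).tangent ∞
      (fun x => (Bundle.TotalSpace.mk' E x (Y x) : TangentBundle 𝓘(ℝ, E) M)) →
    ∀ x : M,
      VectorField.mlieBracket 𝓘(ℝ, E) (fun y => J.toFun y (X y)) (fun y => J.toFun y (Y y)) x
        - J.toFun x (VectorField.mlieBracket 𝓘(ℝ, E) (fun y => J.toFun y (X y)) Y x)
        - J.toFun x (VectorField.mlieBracket 𝓘(ℝ, E) X (fun y => J.toFun y (Y y)) x)
        - VectorField.mlieBracket 𝓘(ℝ, E) X Y x = 0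

/-! ### Exterior calculus of two-forms and the Lee form -/

/-- The exterior derivative at `x` of a two-form `B` on `M`, computed in the chart `φ` at `x`:
`dB (u, v, w) = D_u B (v, w) - D_v B (u, w) + D_w B (u, v)`, where `B` is pulled back by `φ⁻¹` and
`u, v, w` are pushed forward by `φ`. -/
def extDerivTwo (B : ∀ x : M, TangentSpace 𝓘(ℝ, E) x →ₗ[ℝ] TangentSpace 𝓘(ℝ, E) x →ₗ[ℝ] ℝ)
    (x : M) (u v w : TangentSpace 𝓘(ℝ, E) x) : ℝ :=
  let φ := extChartAt 𝓘(ℝ, E) x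
  let push : TangentSpace 𝓘(ℝ, E) x → E := fun a => mfderiv 𝓘(ℝ, E) 𝓘(ℝ, E) φ x a
  let coef : E → E → E → ℝ := fun a b y =>
    B (φ.symm y) (mfderiv 𝓘(ℝ, E) 𝓘(ℝ, E) φ.symm y a) (mfderiv 𝓘(ℝ, E) 𝓘(ℝ, E) φ.symm y b)
  fderiv ℝ (coef (push v) (push w)) (φ x) (push u)
    - fderiv ℝ (coef (push u) (push w)) (φ x) (push v)
    + fderiv ℝ (coef (push u) (push v)) (φ x) (push w)

/-- The fundamental two-form `Ω_g (u, v) = g (J u, v)`. -/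
def Metric.fundForm (g : Metric E M) (J : AlmostComplexStructure E M) (x : M) :
    TangentSpace 𝓘(ℝ, E) x →ₗ[ℝ] TangentSpace 𝓘(ℝ, E) x →ₗ[ℝ] ℝ :=
  (g.form x).comp (J.toFun x).toLinearMap

/-- The Lee form `ω_g`: at each point, the covector `η` such that `dΩ_g = η ∧ Ω_g`. On a locally
conformal Kähler manifold it exists, and it is unique since the real dimension is at least `4`. -/
def Metric.leeForm (g : Metric E M) (J : AlmostComplexStructure E M) (x : M) :
    TangentSpace 𝓘(ℝ, E) x →ₗ[ℝ] ℝ :=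
  Classical.epsilon fun η : TangentSpace 𝓘(ℝ, E) x →ₗ[ℝ] ℝ =>
    ∀ u v w : TangentSpace 𝓘(ℝ, E) x,
      extDerivTwo (g.fundForm J) x u v w =
        η u * g.fundForm J x v w - η v * g.fundForm J x u w + η w * g.fundForm J x u v

/-- The twisted differential `d^{ω_g} f = df - f ω_g` of a function. -/
def Metric.twistedDiff (g : Metric E M) (J : AlmostComplexStructure E M) (f : M → ℝ) (x : M) :
    TangentSpace 𝓘(ℝ, E) x →ₗ[ℝ] ℝ :=
  (mvfderiv 𝓘(ℝ, E) f x).toLinearMap - f x • g.leeForm J x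

/-- The twisted Poisson bracket `{f₁, f₂} = Ω_g (♯ d^{ω_g} f₁, ♯ d^{ω_g} f₂)`. -/
def Metric.poisson (g : Metric E M) (J : AlmostComplexStructure E M) (f₁ f₂ : M → ℝ) (x : M) : ℝ :=
  g.fundForm J x (sharp (g.fundForm J x) (g.twistedDiff J f₁ x))
    (sharp (g.fundForm J x) (g.twistedDiff J f₂ x))

/-- `g` is locally conformal to Kähler metrics for `J`, the integrability of `J` and the Hermitian
property of `g` being understood: near every point there is a smooth `α` such that the fundamental
form `e^{-α} Ω_g` of `e^{-α} g` is closed. -/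
def Metric.IsLocallyConformalKahler (g : Metric E M) (J : AlmostComplexStructure E M) : Prop :=
  ∀ x : M, ∃ (U : Set M) (α : M → ℝ), IsOpen U ∧ x ∈ U ∧
    ContMDiffOn 𝓘(ℝ, E) 𝓘(ℝ, ℝ) ∞ α U ∧
    ∀ y ∈ U, ∀ u v w : TangentSpace 𝓘(ℝ, E) y,
      extDerivTwo (fun z => Real.exp (-α z) • g.fundForm J z) y u v w = 0

/-! ### Conformal structures -/

variable (E M) in
/-- A conformal structure on `M`: the section `c = g ⊗ l_g²` of `S²M ⊗ L²_M` defined by the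
conformal class of a Riemannian metric `g`. -/
structure ConformalStructure where
  /-- The bilinear form on each tangent space, with values in the densities of weight `2`. -/
  toFun : ∀ x : M, TangentSpace 𝓘(ℝ, E) x →ₗ[ℝ] TangentSpace 𝓘(ℝ, E) x →ₗ[ℝ] DensityAt E 2 x
  exists_metric : ∃ g : Metric E M, ∀ (x : M) (u v : TangentSpace 𝓘(ℝ, E) x),
    toFun x u v = g.inner x u v • g.scale 2 x

/-- The metric `g` belongs to the conformal class `c`, that is, `c = g ⊗ l_g²`. -/
def ConformalStructure.IsGauge (c : ConformalStructure E M) (g : Metric E M) : Prop :=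
  ∀ (x : M) (u v : TangentSpace 𝓘(ℝ, E) x), c.toFun x u v = g.inner x u v • g.scale 2 x

/-- A metric of the conformal class. -/
def ConformalStructure.refMetric (c : ConformalStructure E M) : Metric E M :=
  Classical.choose c.exists_metric

/-- `(M, c, J)` is a locally conformal Kähler manifold: `J` is integrable and compatible with `c`,
and some metric of the class (hence every one) is locally conformal Kähler; the complex dimension
is bigger than `1`. -/
structure IsLCKManifold (c : ConformalStructure E M) (J : AlmostComplexStructure E M) : Prop where
  dim : 4 ≤ Module.finrank ℝ E
  integrable : J.IsIntegrable
  hermitian : ∀ (x : M) (u v : TangentSpace 𝓘(ℝ, E) x),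
    c.toFun x (J.toFun x u) (J.toFun x v) = c.toFun x u v
  lck : ∃ g : Metric E M, c.IsGauge g ∧ g.IsLocallyConformalKahler J

/-- A diffeomorphism `h` of `M` is an automorphism of `(M, c, J)`: it preserves `J`, and for every
metric `g` of the class, `h^* g` is conformal to `g`. -/
structure IsAutomorphism (c : ConformalStructure E M) (J : AlmostComplexStructure E M)
    (h : M ≃ₘ^∞⟮𝓘(ℝ, E), 𝓘(ℝ, E)⟯ M) : Prop where
  map_J : ∀ (x : M) (v : TangentSpace 𝓘(ℝ, E) x),
    mfderiv 𝓘(ℝ, E) 𝓘(ℝ, E) h x (J.toFun x v) = J.toFun (h x) (mfderiv 𝓘(ℝ, E) 𝓘(ℝ, E) h x v)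
  conformal : ∀ g : Metric E M, c.IsGauge g → ∃ α : SmoothFun E M,
    ∀ (x : M) (u v : TangentSpace 𝓘(ℝ, E) x),
      g.inner (h x) (mfderiv 𝓘(ℝ, E) 𝓘(ℝ, E) h x u) (mfderiv 𝓘(ℝ, E) 𝓘(ℝ, E) h x v)
        = Real.exp (α x) * g.inner x u v

/-- The fundamental form `Ω (u, v) = c (J u, v)` with values in `L²_M`. -/
def ConformalStructure.fundForm (c : ConformalStructure E M) (J : AlmostComplexStructure E M)
    (x : M) : TangentSpace 𝓘(ℝ, E) x →ₗ[ℝ] TangentSpace 𝓘(ℝ, E) x →ₗ[ℝ] DensityAt E 2 x :=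
  (c.toFun x).comp (J.toFun x).toLinearMap

/-- The canonical Weyl connection on `L^t_M`. On `L¹_M` it is the connection such that
`∇ l_g = -(1/2) ω_g ⊗ l_g`, and the connection induced on `L^t_M` satisfies
`∇ l_g^t = -(t/2) ω_g ⊗ l_g^t`, so that
`∇ (f l_g^t) = (df - (t/2) f ω_g) ⊗ l_g^t`. The metric `g` of the conformal class is arbitrary:
since `l_{e^α g} = e^{-α/2} l_g` and `ω_{e^α g} = ω_g + dα`, the result does not depend on it. -/
def ConformalStructure.weyl (c : ConformalStructure E M) (J : AlmostComplexStructure E M) {t : ℝ}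
    (s : ∀ x : M, DensityAt E t x) (x : M) : TangentSpace 𝓘(ℝ, E) x →ₗ[ℝ] DensityAt E t x :=
  let g := c.refMetric
  let f : M → ℝ := fun y => densityRatio (s y) (g.scale t y)
  ((mvfderiv 𝓘(ℝ, E) f x).toLinearMap - (t / 2 * f x) • g.leeForm J x).smulRight (g.scale t x)

/-- The Poisson bracket `{s₁, s₂} = Ω (♯ ∇ s₁, ♯ ∇ s₂)` of sections of `L²_M`. -/
def ConformalStructure.poisson (c : ConformalStructure E M) (J : AlmostComplexStructure E M)
    (s₁ s₂ : ∀ x : M, DensityAt E 2 x) (x : M) : DensityAt E 2 x :=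
  c.fundForm J x (sharp (c.fundForm J x) (c.weyl J s₁ x)) (sharp (c.fundForm J x) (c.weyl J s₂ x))

/-! ### Momentum maps -/

variable {EG : Type*} [NormedAddCommGroup EG] [NormedSpace ℝ EG]
  {G : Type*} [TopologicalSpace G] [ChartedSpace EG G] [Group G] [MulAction G M]

/-- The fundamental vector field of `X ∈ 𝔤`, that is, `x ↦ d/dt|₀ (exp (t X) • x)`. -/
def fundField (X : GroupLieAlgebra 𝓘(ℝ, EG) G) (x : M) : TangentSpace 𝓘(ℝ, E) x :=
  mfderiv 𝓘(ℝ, EG) 𝓘(ℝ, E) (fun a : G => a • x) 1 X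

/-- `μ : 𝔤 → Γ(L²_M)` is a momentum map for the conformal structure: a homomorphism of Lie
algebras such that `ι_X Ω = ∇ μ^X` for all `X ∈ 𝔤`. -/
structure IsConformalMomentumMap (c : ConformalStructure E M) (J : AlmostComplexStructure E M)
    (μ : GroupLieAlgebra 𝓘(ℝ, EG) G → DensitySection E M 2) : Prop where
  linear : IsLinearMap ℝ μ
  map_lie : ∀ (X Y : GroupLieAlgebra 𝓘(ℝ, EG) G) (x : M),
    (μ ⁅X, Y⁆).1 x = c.poisson J (μ X).1 (μ Y).1 x
  contraction : ∀ (X : GroupLieAlgebra 𝓘(ℝ, EG) G) (x : M),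
    c.fundForm J x (fundField X x) = c.weyl J (μ X).1 x

/-- `ν : 𝔤 → C^∞(M)` is a (twisted Hamiltonian) momentum map with respect to the metric `g`: a
homomorphism of Lie algebras for the twisted Poisson bracket, such that
`ι_X Ω_g = d^{ω_g} ν^X` for all `X ∈ 𝔤`. -/
structure IsTwistedMomentumMap (g : Metric E M) (J : AlmostComplexStructure E M)
    (ν : GroupLieAlgebra 𝓘(ℝ, EG) G → SmoothFun E M) : Prop where
  linear : IsLinearMap ℝ ν
  map_lie : ∀ (X Y : GroupLieAlgebra 𝓘(ℝ, EG) G) (x : M),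
    ν ⁅X, Y⁆ x = g.poisson J (ν X) (ν Y) x
  contraction : ∀ (X : GroupLieAlgebra 𝓘(ℝ, EG) G) (x : M),
    g.fundForm J x (fundField X x) = g.twistedDiff J (ν X) x

/-- `μ = ν ⊗ l_g²`. -/
def IsGaugeForm (g : Metric E M) (μ : GroupLieAlgebra 𝓘(ℝ, EG) G → DensitySection E M 2)
    (ν : GroupLieAlgebra 𝓘(ℝ, EG) G → SmoothFun E M) : Prop :=
  ∀ (X : GroupLieAlgebra 𝓘(ℝ, EG) G) (x : M), (μ X).1 x = ν X x • g.scale 2 x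

end Manifold

end LCK

end

/-! A metric `g` of the class trivialises `L²_M`: `l_g²` is smooth and nowhere zero, so `f ↦ f l_g²`
identifies smooth functions with smooth sections (`Metric.exists_eq_smul_scale`). Under this
identification `Ω` is `Ω_g ⊗ l_g²`, and the Weyl connection is the twisted differential tensored
with `l_g²` (`IsLCKManifold.weyl_eq`). The factor `l_g²` cancels in `♯∇`, so the Poisson brackets
correspond as well. Each condition on `μ` is then the same condition on `μ_g` multiplied by a
nonzero density.

The substance lies in `weyl_eq`, since `∇` is defined through one chosen metric `r` of the class. If
`l_g² = κ l_r²`, then `Ω_r = κ Ω_g`, and Leibniz gives `ω_r = ω_g + dκ/κ` once the Lee form is known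
to be unique. The correction `dκ/κ` cancels the extra term of `d(fκ)`. Existence of Lee forms comes
from the local Kähler metrics. Uniqueness comes from injectivity of `η ↦ η ∧ Ω_g` in real dimension
at least four (`eq_zero_of_wedge_eq_zero`). -/

namespace LCK

/-! ### Linear algebra of densities and Hermitian two-forms -/

section VectorSpace

variable {V : Type*} [AddCommGroup V] [Module ℝ V]

/-- The Gram determinant of a linearly independent family is positive. -/
lemma gram_det_pos {n : ℕ} (b : V →ₗ[ℝ] V →ₗ[ℝ] ℝ) (hsymm : ∀ u v, b u v = b v u)
    (hpos : ∀ v, v ≠ 0 → 0 < b v v) {v : Fin n → V} (hv : LinearIndependent ℝ v) :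
    0 < (Matrix.of fun i j => b (v j) (v i)).det := by
  refine Matrix.PosDef.det_pos (Matrix.posDef_iff_dotProduct_mulVec.2 ⟨?_, fun a ha => ?_⟩)
  · ext i j
    simpa using hsymm _ _
  · have hne : ∑ i, a i • v i ≠ 0 := fun h =>
      ha (funext fun i => Fintype.linearIndependent_iff.1 hv a h i)
    -- The quadratic form of the Gram matrix at `a` is `b` evaluated twice on `∑ aᵢ vᵢ`.
    refine (hpos _ hne).trans_eq ?_
    simp only [map_sum, map_smul, LinearMap.sum_apply, LinearMap.smul_apply, smul_eq_mul,
      dotProduct, Matrix.mulVec, Matrix.of_apply, Pi.star_apply, star_trivial]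
    refine Finset.sum_congr rfl fun i _ => ?_
    congr 1
    exact Finset.sum_congr rfl fun j _ => mul_comm _ _

lemma extLength_ιMulti (b : V →ₗ[ℝ] V →ₗ[ℝ] ℝ) (v : Fin (Module.finrank ℝ V) → V) :
    extLength b (exteriorPower.ιMulti ℝ _ v)
      = Real.sqrt (Matrix.of fun i j => b (v j) (v i)).det := by
  simp [extLength, exteriorPower.map_apply_ιMulti]

lemma ιMulti_ne_zero {n : ℕ} {v : Fin n → V} (hv : LinearIndependent ℝ v) :
    exteriorPower.ιMulti ℝ n v ≠ 0 := by
  have h := (exteriorPower.ιMulti_family_linearIndependent_field (n := n) hv).ne_zero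
    ⟨Finset.univ, by simp⟩
  intro h0
  apply h
  rw [exteriorPower.ιMulti_family]
  convert h0
  ext i
  rw [Function.comp_apply]
  congr 1
  -- An order embedding of `Fin n` into itself is onto, and its range determines it, so the family
  -- indexed by `n`-subsets has `v` itself as the factor at `univ`.
  have hrange : ∀ f : Fin n ↪o Fin n, Set.range f = Set.univ := fun f =>
    (Finite.injective_iff_surjective.1 f.injective).range_eq
  exact DFunLike.congr_fun (OrderEmbedding.range_inj.1
    ((hrange _).trans (hrange (RelEmbedding.refl _)).symm)) i

lemma exists_smul_ιMulti [FiniteDimensional ℝ V] {v : Fin (Module.finrank ℝ V) → V}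
    (hv : LinearIndependent ℝ v) (w : ⋀[ℝ]^(Module.finrank ℝ V) V) :
    ∃ a : ℝ, a • exteriorPower.ιMulti ℝ _ v = w :=
  (finrank_eq_one_iff_of_nonzero' _ (ιMulti_ne_zero hv)).1
    (by rw [exteriorPower.finrank_eq, Nat.choose_self]) w

lemma densityEval_of_ne_zero {t : ℝ} (l : Density t V) {w : ⋀[ℝ]^(Module.finrank ℝ V) V}
    (hw : w ≠ 0) : densityEval l w = l.1 ⟨w, hw⟩ := by
  simp [densityEval, hw]

/-- A density is determined by its value on the exterior product of a basis. -/
lemma density_ext [FiniteDimensional ℝ V] {t : ℝ} {v : Fin (Module.finrank ℝ V) → V}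
    (hv : LinearIndependent ℝ v) {s l : Density t V}
    (h : densityEval s (exteriorPower.ιMulti ℝ _ v) = densityEval l (exteriorPower.ιMulti ℝ _ v)) :
    s = l := by
  have h0 := ιMulti_ne_zero hv
  rw [densityEval_of_ne_zero _ h0, densityEval_of_ne_zero _ h0] at h
  ext ⟨w, hw⟩
  obtain ⟨a, rfl⟩ := exists_smul_ιMulti hv w
  have ha : a ≠ 0 := fun h => hw (by rw [h, zero_smul])
  rw [s.2 a ha ⟨_, h0⟩, l.2 a ha ⟨_, h0⟩, h]

lemma densityEval_lengthDensity_ιMulti (b : V →ₗ[ℝ] V →ₗ[ℝ] ℝ) (t : ℝ)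
    {v : Fin (Module.finrank ℝ V) → V} (hv : LinearIndependent ℝ v) :
    densityEval (lengthDensity b t) (exteriorPower.ιMulti ℝ _ v)
      = Real.sqrt (Matrix.of fun i j => b (v j) (v i)).det
          ^ (-t / (Module.finrank ℝ V : ℝ)) := by
  rw [densityEval_of_ne_zero _ (ιMulti_ne_zero hv)]
  simp only [lengthDensity, extLength_ιMulti]

lemma densityEval_lengthDensity_pos (b : V →ₗ[ℝ] V →ₗ[ℝ] ℝ) (hsymm : ∀ u v, b u v = b v u)
    (hpos : ∀ v, v ≠ 0 → 0 < b v v) (t : ℝ)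
    {v : Fin (Module.finrank ℝ V) → V} (hv : LinearIndependent ℝ v) :
    0 < densityEval (lengthDensity b t) (exteriorPower.ιMulti ℝ _ v) := by
  rw [densityEval_lengthDensity_ιMulti _ _ hv]
  exact Real.rpow_pos_of_pos (Real.sqrt_pos.2 (gram_det_pos b hsymm hpos hv)) _

lemma lengthDensity_ne_zero [FiniteDimensional ℝ V] (b : V →ₗ[ℝ] V →ₗ[ℝ] ℝ)
    (hsymm : ∀ u v, b u v = b v u) (hpos : ∀ v, v ≠ 0 → 0 < b v v) (t : ℝ) :
    lengthDensity b t ≠ 0 := fun h => by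
  have := densityEval_lengthDensity_pos b hsymm hpos t
    (Module.finBasis ℝ V).linearIndependent
  rw [h, density_eval_zero] at this
  exact this.false

lemma densityRatio_smul {t : ℝ} (r : ℝ) {l : Density t V} (hl : l ≠ 0) :
    densityRatio (r • l) l = r := by
  have h : r • l = densityRatio (r • l) l • l :=
    Classical.epsilon_spec (p := fun r' : ℝ => r • l = r' • l) ⟨r, rfl⟩
  exact (smul_left_injective ℝ hl h).symm

/-- `♯` is unchanged when the two-form and the one-form are multiplied by the same scale. -/
lemma sharp_smulRight {L : Type*} [AddCommGroup L] [Module ℝ L] {l : L} (hl : l ≠ 0)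
    (Ω : V →ₗ[ℝ] V →ₗ[ℝ] ℝ) (Ω' : V →ₗ[ℝ] V →ₗ[ℝ] L) (h : ∀ u v, Ω' u v = Ω u v • l)
    (α : V →ₗ[ℝ] ℝ) : sharp Ω' (α.smulRight l) = sharp Ω α := by
  unfold sharp
  -- The two choices are made from the same predicate, so they agree even where no solution exists;
  -- non-degeneracy is not needed.
  congr 1
  ext v
  simp only [LinearMap.ext_iff, h, LinearMap.smulRight_apply]
  exact forall_congr' fun u => (smul_left_injective ℝ hl).eq_iff

/-- If `η ∧ Ω = 0` with `Ω = b (J ·, ·)` the fundamental form of a Hermitian structure on a space of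
dimension at least `4`, then `η = 0`. -/
lemma eq_zero_of_wedge_eq_zero [FiniteDimensional ℝ V] (hdim : 4 ≤ Module.finrank ℝ V)
    (b : V →ₗ[ℝ] V →ₗ[ℝ] ℝ) (hpos : ∀ v, v ≠ 0 → 0 < b v v)
    (J : V →ₗ[ℝ] V) (hb : ∀ u v, b (J u) (J v) = b u v)
    (η : V →ₗ[ℝ] ℝ)
    (h : ∀ u v w, η u * b (J v) w - η v * b (J u) w + η w * b (J u) v = 0) : η = 0 := by
  ext u
  -- Two linear conditions on a space of dimension at least four leave a nonzero `v` orthogonal to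
  -- both `u` and `J u`.
  let T : V →ₗ[ℝ] ℝ × ℝ := (b u).prod (b (J u))
  obtain ⟨v, hvT, hv⟩ : ∃ v ∈ LinearMap.ker T, v ≠ 0 := by
    rw [← Submodule.ne_bot_iff]
    refine LinearMap.ker_ne_bot_of_finrank_lt ?_
    rw [Module.finrank_prod, Module.finrank_self]
    omega
  obtain ⟨h1, h2⟩ : b u v = 0 ∧ b (J u) v = 0 := by simpa [T] using hvT
  -- On `(u, v, J v)` the last two terms vanish by orthogonality, leaving `η u * b v v = 0`.
  have := h u v (J v)
  rw [hb, hb, h1, h2] at this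
  have := hpos v hv
  simp_all [this.ne']

end VectorSpace

/-! ### Smooth trivialisation of the density bundles by a metric -/

section Manifold

variable {E : Type*} [NormedAddCommGroup E] [NormedSpace ℝ E]
  {M : Type*} [TopologicalSpace M] [ChartedSpace E M] [IsManifold 𝓘(ℝ, E) ∞ M]

lemma Metric.form_symm (g : Metric E M) (x : M) (u v : TangentSpace 𝓘(ℝ, E) x) :
    g.form x u v = g.form x v u := g.symm x u v

lemma Metric.form_pos (g : Metric E M) (x : M) (v : TangentSpace 𝓘(ℝ, E) x) (hv : v ≠ 0) :
    0 < g.form x v v := g.pos x v hv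

/-- The fields are taken along a map `p` so that both frames on `M` and coordinate fields
parametrised by the model space `E` are covered. -/
lemma Metric.contMDiffWithinAt_inner (g : Metric E M)
    {F : Type*} [NormedAddCommGroup F] [NormedSpace ℝ F]
    {N : Type*} [TopologicalSpace N] [ChartedSpace F N] {s : Set N} {x : N} {p : N → M}
    {X Y : ∀ y : N, TangentSpace 𝓘(ℝ, E) (p y)}
    (hX : ContMDiffWithinAt 𝓘(ℝ, F) 𝓘(ℝ, E).tangent ∞
      (fun y => (Bundle.TotalSpace.mk' E (p y) (X y) : TangentBundle 𝓘(ℝ, E) M)) s x)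
    (hY : ContMDiffWithinAt 𝓘(ℝ, F) 𝓘(ℝ, E).tangent ∞
      (fun y => (Bundle.TotalSpace.mk' E (p y) (Y y) : TangentBundle 𝓘(ℝ, E) M)) s x) :
    ContMDiffWithinAt 𝓘(ℝ, F) 𝓘(ℝ, ℝ) ∞ (fun y => g.inner (p y) (X y) (Y y)) s x := by
  have h : ContMDiffWithinAt 𝓘(ℝ, F) (𝓘(ℝ, E).prod 𝓘(ℝ)) ∞
      (fun y => Bundle.TotalSpace.mk' ℝ (E := Bundle.Trivial M ℝ) (p y)
        (g.inner (p y) (X y) (Y y))) s x := by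
    refine ContMDiffWithinAt.clm_bundle_apply₂ (F₁ := E) (F₂ := E) ?_ hX hY
    exact g.contMDiff.contMDiffAt.comp_contMDiffWithinAt x
      (Bundle.contMDiffWithinAt_totalSpace.1 hX).1
  exact (Bundle.contMDiffWithinAt_totalSpace.1 h).2

/-- The section `l_g^t` is smooth. -/
lemma Metric.scale_mem (g : Metric E M) (t : ℝ) : g.scale t ∈ DensitySection E M t := by
  intro U X hU hX hX' x hx
  have heq : ∀ y ∈ U, _ = _ := fun y hy =>
    densityEval_lengthDensity_ιMulti (g.form y) t (hX' y hy)
  refine ContMDiffWithinAt.congr ?_ heq (heq x hx)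
  have hdet : ContMDiffWithinAt 𝓘(ℝ, E) 𝓘(ℝ, ℝ) ∞
      (fun y => (Matrix.of fun i j => g.form y (X j y) (X i y)).det) U x := by
    simp only [Matrix.det_apply']
    refine ContMDiffWithinAt.sum fun σ _ => ?_
    refine contMDiffWithinAt_const.mul (contMDiffWithinAt_finsetProd fun i _ => ?_)
    exact g.contMDiffWithinAt_inner (hX _ x hx) (hX _ x hx)
  have hpos := gram_det_pos (g.form x) (g.form_symm x) (g.form_pos x) (hX' x hx)
  -- Square root and real power are smooth away from zero, which is where positivity of the Gram
  -- determinant enters.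
  have h1 : ContDiffAt ℝ ∞ (fun r : ℝ => Real.sqrt r ^ (-t / (Module.finrank ℝ E : ℝ)))
      (Matrix.of fun i j => g.form x (X j x) (X i x)).det :=
    (Real.contDiffAt_sqrt hpos.ne').rpow_const_of_ne (Real.sqrt_pos.2 hpos).ne'
  exact h1.contMDiffAt.comp_contMDiffWithinAt x hdet

section FiniteDimensional

variable [FiniteDimensional ℝ E]

instance (x : M) : FiniteDimensional ℝ (TangentSpace 𝓘(ℝ, E) x) :=
  inferInstanceAs (FiniteDimensional ℝ E)

lemma Metric.scale_ne_zero (g : Metric E M) (t : ℝ) (x : M) : g.scale t x ≠ 0 :=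
  lengthDensity_ne_zero _ (g.form_symm x) (g.form_pos x) t

/-- A smooth section of `L^t_M` is a smooth multiple of `l_g^t`. -/
lemma Metric.exists_eq_smul_scale (g : Metric E M) {t : ℝ} (s : DensitySection E M t) :
    ∃ f : SmoothFun E M, ∀ x, s.1 x = f x • g.scale t x := by
  let B := Module.finBasis ℝ E
  let T := fun x : M => trivializationAt E (TangentSpace 𝓘(ℝ, E)) x
  let X := fun x : M => (T x).localFrame B
  let w := fun x y : M => exteriorPower.ιMulti ℝ (Module.finrank ℝ (TangentSpace 𝓘(ℝ, E) y))
    fun i => X x i y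
  have hli : ∀ x, ∀ y ∈ (T x).baseSet, LinearIndependent ℝ fun i => X x i y := fun x y hy =>
    ((T x).isLocalFrameOn_localFrame_baseSet 𝓘(ℝ, E) ∞ B).linearIndependent hy
  have hsm : ∀ x i, ContMDiffOn 𝓘(ℝ, E) 𝓘(ℝ, E).tangent ∞
      (fun y => (Bundle.TotalSpace.mk' E y (X x i y) : TangentBundle 𝓘(ℝ, E) M)) (T x).baseSet :=
    fun x i => (T x).contMDiffOn_localFrame_baseSet ∞ B i
  have hmem : ∀ x, x ∈ (T x).baseSet := fun x =>
    FiberBundle.mem_baseSet_trivializationAt E (TangentSpace 𝓘(ℝ, E)) x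
  have hpos : ∀ x, ∀ y ∈ (T x).baseSet, 0 < densityEval (g.scale t y) (w x y) := fun x y hy =>
    densityEval_lengthDensity_pos _ (g.form_symm y) (g.form_pos y) t (hli x y hy)
  let q : M → M → ℝ := fun x y => densityEval (s.1 y) (w x y) / densityEval (g.scale t y) (w x y)
  have hext : ∀ (y : M) (v : Fin (Module.finrank ℝ (TangentSpace 𝓘(ℝ, E) y)) → _)
      (_ : LinearIndependent ℝ v) (s l : DensityAt E t y), densityEval s (exteriorPower.ιMulti ℝ _ v)
        = densityEval l (exteriorPower.ιMulti ℝ _ v) → s = l := fun y v hv s l => density_ext hv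
  have hq : ∀ x, ∀ y ∈ (T x).baseSet, s.1 y = q x y • g.scale t y := fun x y hy =>
    hext y _ (hli x y hy) _ _ (by
      refine Eq.trans ?_ (density_eval_smul _ _ _).symm
      exact (div_mul_cancel₀ _ (hpos x y hy).ne').symm)
  -- The coefficient at `x` is read in the frame centred at `x`. As `l_g^t` is nonzero, the
  -- coefficient does not depend on the frame, so it agrees near `x` with the smooth quotient `q x`.
  refine ⟨⟨fun x => q x x, fun x => ?_⟩, fun x => hq x x (hmem x)⟩
  have hqx : ContMDiffAt 𝓘(ℝ, E) 𝓘(ℝ, ℝ) ∞ (q x) x := by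
    refine ContMDiffOn.contMDiffAt (s := (T x).baseSet) ?_
      ((T x).open_baseSet.mem_nhds (hmem x))
    exact (s.2 _ (X x) (T x).open_baseSet (hsm x) (hli x)).div₀
      (g.scale_mem t _ (X x) (T x).open_baseSet (hsm x) (hli x)) fun y hy => (hpos x y hy).ne'
  refine hqx.congr_of_eventuallyEq ?_
  filter_upwards [(T x).open_baseSet.mem_nhds (hmem x)] with y hy
  exact smul_left_injective ℝ (g.scale_ne_zero t y)
    ((hq y y (hmem y)).symm.trans (hq x y hy))

end FiniteDimensional

end Manifold

/-! ### Exterior derivative of rescaled two-forms and Lee covectors -/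

section Manifold

variable {E : Type*} [NormedAddCommGroup E] [NormedSpace ℝ E]
  {M : Type*} [TopologicalSpace M] [ChartedSpace E M]

/-- The coefficient `B (a, b)` of a two-form `B` read in the chart at `x`. -/
noncomputable def twoFormCoef
    (B : ∀ x : M, TangentSpace 𝓘(ℝ, E) x →ₗ[ℝ] TangentSpace 𝓘(ℝ, E) x →ₗ[ℝ] ℝ)
    (x : M) (a b : E) (y : E) : ℝ :=
  let φ := extChartAt 𝓘(ℝ, E) x
  B (φ.symm y) (mfderiv 𝓘(ℝ, E) 𝓘(ℝ, E) φ.symm y a) (mfderiv 𝓘(ℝ, E) 𝓘(ℝ, E) φ.symm y b)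

lemma twoFormCoef_smul (f : M → ℝ)
    (B : ∀ x : M, TangentSpace 𝓘(ℝ, E) x →ₗ[ℝ] TangentSpace 𝓘(ℝ, E) x →ₗ[ℝ] ℝ) (x : M) (a b : E) :
    twoFormCoef (fun z => f z • B z) x a b
      = fun y => f ((extChartAt 𝓘(ℝ, E) x).symm y) * twoFormCoef B x a b y := rfl

variable [IsManifold 𝓘(ℝ, E) ∞ M]

lemma extChartAt_symm_contMDiffAt (x : M) :
    ContMDiffAt 𝓘(ℝ, E) 𝓘(ℝ, E) ∞ (extChartAt 𝓘(ℝ, E) x).symm (extChartAt 𝓘(ℝ, E) x x) :=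
  (contMDiffOn_extChartAt_symm x).contMDiffAt (extChartAt_target_mem_nhds x)

lemma mdifferentiableAt_extChartAt_self (x : M) :
    MDifferentiableAt 𝓘(ℝ, E) 𝓘(ℝ, E) (extChartAt 𝓘(ℝ, E) x) x :=
  mdifferentiableAt_extChartAt (mem_chart_source E x)

lemma mdifferentiableAt_comp_extChartAt_symm {f : M → ℝ} {x : M}
    (hf : MDifferentiableAt 𝓘(ℝ, E) 𝓘(ℝ, ℝ) f x) :
    DifferentiableAt ℝ (fun y => f ((extChartAt 𝓘(ℝ, E) x).symm y)) (extChartAt 𝓘(ℝ, E) x x) := by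
  rw [← mdifferentiableAt_iff_differentiableAt]
  refine MDifferentiableAt.comp _ ?_ ((extChartAt_symm_contMDiffAt x).mdifferentiableAt (by simp))
  rwa [extChartAt_to_inv]

/-- Chain rule for `f = F ∘ φ` near `x`; it turns the chart derivatives in `extDerivTwo` into the
intrinsic `df`. -/
lemma fderiv_comp_extChartAt_symm {f : M → ℝ} {x : M}
    (hf : MDifferentiableAt 𝓘(ℝ, E) 𝓘(ℝ, ℝ) f x) (u : TangentSpace 𝓘(ℝ, E) x) :
    fderiv ℝ (fun y => f ((extChartAt 𝓘(ℝ, E) x).symm y)) (extChartAt 𝓘(ℝ, E) x x)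
      (mfderiv 𝓘(ℝ, E) 𝓘(ℝ, E) (extChartAt 𝓘(ℝ, E) x) x u) = mvfderiv 𝓘(ℝ, E) f x u := by
  set F : E → ℝ := fun y => f ((extChartAt 𝓘(ℝ, E) x).symm y) with hF
  have hFd := mdifferentiableAt_comp_extChartAt_symm hf
  have heq : f =ᶠ[nhds x] F ∘ extChartAt 𝓘(ℝ, E) x := by
    filter_upwards [extChartAt_source_mem_nhds (I := 𝓘(ℝ, E)) x] with y hy
    exact congrArg f ((extChartAt 𝓘(ℝ, E) x).left_inv hy).symm
  have h : mfderiv 𝓘(ℝ, E) 𝓘(ℝ, ℝ) f x = _ := heq.mfderiv_eq.trans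
    (mfderiv_comp x hFd.mdifferentiableAt (mdifferentiableAt_extChartAt_self x))
  unfold mvfderiv
  rw [h, mfderiv_eq_fderiv]
  rfl

/-- `d (f B) = df ∧ B + f dB`. -/
lemma extDerivTwo_smul {f : M → ℝ}
    {B : ∀ x : M, TangentSpace 𝓘(ℝ, E) x →ₗ[ℝ] TangentSpace 𝓘(ℝ, E) x →ₗ[ℝ] ℝ} {x : M}
    (hf : MDifferentiableAt 𝓘(ℝ, E) 𝓘(ℝ, ℝ) f x)
    (hB : ∀ a b, DifferentiableAt ℝ (twoFormCoef B x a b) (extChartAt 𝓘(ℝ, E) x x))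
    (u v w : TangentSpace 𝓘(ℝ, E) x) :
    extDerivTwo (fun z => f z • B z) x u v w
      = mvfderiv 𝓘(ℝ, E) f x u * B x v w - mvfderiv 𝓘(ℝ, E) f x v * B x u w
        + mvfderiv 𝓘(ℝ, E) f x w * B x u v + f x * extDerivTwo B x u v w := by
  set φ := extChartAt 𝓘(ℝ, E) x with hφ
  set p : TangentSpace 𝓘(ℝ, E) x → E := fun a => mfderiv 𝓘(ℝ, E) 𝓘(ℝ, E) φ x a with hp
  have hcoef : ∀ a b, twoFormCoef B x (p a) (p b) (φ x) = B x a b := by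
    intro a b
    have hinv : ∀ c, mfderiv 𝓘(ℝ, E) 𝓘(ℝ, E) φ.symm (φ x) (p c) = c := fun c => by
      have h := mfderivWithin_extChartAt_symm_comp_mfderiv_extChartAt' (I := 𝓘(ℝ, E))
        (mem_extChartAt_source (I := 𝓘(ℝ, E)) x)
      rw [modelWithCornersSelf_coe, Set.range_id, mfderivWithin_univ] at h
      exact DFunLike.congr_fun h c
    -- The point `φ.symm (φ x)` equals `x` only propositionally, so the value of `B` is transported
    -- along a variable base point.
    have hbase : ∀ z, z = x → ∀ a b : E, B z a b = B x a b := by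
      rintro _ rfl _ _
      rfl
    refine (hbase _ (extChartAt_to_inv x) _ _).trans ?_
    exact congrArg₂ (fun a b => B x a b) (hinv a) (hinv b)
  have key : ∀ a b c, fderiv ℝ (twoFormCoef (fun z => f z • B z) x (p a) (p b)) (φ x) (p c)
      = mvfderiv 𝓘(ℝ, E) f x c * B x a b
        + f x * fderiv ℝ (twoFormCoef B x (p a) (p b)) (φ x) (p c) := by
    intro a b c
    rw [twoFormCoef_smul, fderiv_fun_mul (mdifferentiableAt_comp_extChartAt_symm hf) (hB _ _)]
    have h1 := fderiv_comp_extChartAt_symm hf c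
    have h2 : φ.symm (φ x) = x := extChartAt_to_inv x
    simp only [add_apply, smul_apply, smul_eq_mul, hcoef,
      ← hφ, h2]
    rw [add_comm, mul_comm (B x a b)]
    congr 2
  have hd : ∀ B' : ∀ x : M, TangentSpace 𝓘(ℝ, E) x →ₗ[ℝ] TangentSpace 𝓘(ℝ, E) x →ₗ[ℝ] ℝ,
      extDerivTwo B' x u v w = fderiv ℝ (twoFormCoef B' x (p v) (p w)) (φ x) (p u)
        - fderiv ℝ (twoFormCoef B' x (p u) (p w)) (φ x) (p v)
        + fderiv ℝ (twoFormCoef B' x (p u) (p v)) (φ x) (p w) := fun _ => rfl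
  rw [hd, hd, key, key, key]
  ring

/-- The coordinate vector fields of the chart at `x` are smooth. -/
lemma contMDiffAt_coordField (x : M) (a : E) :
    ContMDiffAt 𝓘(ℝ, E) 𝓘(ℝ, E).tangent ∞ (fun y : E => (Bundle.TotalSpace.mk' E
      ((extChartAt 𝓘(ℝ, E) x).symm y)
      (mfderiv 𝓘(ℝ, E) 𝓘(ℝ, E) (extChartAt 𝓘(ℝ, E) x).symm y a) : TangentBundle 𝓘(ℝ, E) M))
      (extChartAt 𝓘(ℝ, E) x x) := by
  have hopen := isOpen_extChartAt_target (I := 𝓘(ℝ, E)) x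
  have hsec : ContMDiff 𝓘(ℝ, E) 𝓘(ℝ, E).tangent ∞
      (fun y : E => (Bundle.TotalSpace.mk' E y a : TangentBundle 𝓘(ℝ, E) E)) :=
    contMDiff_vectorSpace_iff_contDiff.2 contDiff_const
  -- A coordinate field is the tangent map of `φ⁻¹` applied to a constant field.
  have htan := (contMDiffOn_extChartAt_symm (I := 𝓘(ℝ, E)) (n := ∞) x).contMDiffOn_tangentMapWithin
    (m := ∞) (by simp) hopen.uniqueMDiffOn
  have hcomp := htan.comp hsec.contMDiffOn (s := (extChartAt 𝓘(ℝ, E) x).target) fun y hy => hy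
  refine (hcomp.congr fun y hy => ?_).contMDiffAt (extChartAt_target_mem_nhds x)
  simp only [Function.comp_apply, tangentMapWithin, mfderivWithin_of_isOpen hopen hy]

lemma Metric.differentiableAt_twoFormCoef (g : Metric E M) (J : AlmostComplexStructure E M)
    (x : M) (a b : E) :
    DifferentiableAt ℝ (twoFormCoef (g.fundForm J) x a b) (extChartAt 𝓘(ℝ, E) x x) := by
  have hJ : ContMDiffAt 𝓘(ℝ, E) 𝓘(ℝ, E).tangent ∞ (fun y : E => (Bundle.TotalSpace.mk' E
      ((extChartAt 𝓘(ℝ, E) x).symm y) (J.toFun _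
        (mfderiv 𝓘(ℝ, E) 𝓘(ℝ, E) (extChartAt 𝓘(ℝ, E) x).symm y a)) : TangentBundle 𝓘(ℝ, E) M))
      (extChartAt 𝓘(ℝ, E) x x) := by
    refine ContMDiffAt.clm_bundle_apply ?_ (contMDiffAt_coordField x a)
    exact J.contMDiff.contMDiffAt.comp _ (extChartAt_symm_contMDiffAt x)
  have h := g.contMDiffWithinAt_inner hJ (contMDiffAt_coordField x b)
  exact ((contMDiffWithinAt_univ.1 h).mdifferentiableAt (by simp)).differentiableAt

/-- The covector `η` satisfies `dB = η ∧ B` at `x`. -/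
def IsLeeCovector (B : ∀ x : M, TangentSpace 𝓘(ℝ, E) x →ₗ[ℝ] TangentSpace 𝓘(ℝ, E) x →ₗ[ℝ] ℝ)
    (x : M) (η : TangentSpace 𝓘(ℝ, E) x →ₗ[ℝ] ℝ) : Prop :=
  ∀ u v w : TangentSpace 𝓘(ℝ, E) x,
    extDerivTwo B x u v w = η u * B x v w - η v * B x u w + η w * B x u v

/-- Leibniz: `d(fB) = df ∧ B + f η ∧ B = (η + df/f) ∧ fB`. -/
lemma IsLeeCovector.smul
    {B : ∀ x : M, TangentSpace 𝓘(ℝ, E) x →ₗ[ℝ] TangentSpace 𝓘(ℝ, E) x →ₗ[ℝ] ℝ} {x : M}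
    {η : TangentSpace 𝓘(ℝ, E) x →ₗ[ℝ] ℝ} (h : IsLeeCovector B x η)
    (hB : ∀ a b, DifferentiableAt ℝ (twoFormCoef B x a b) (extChartAt 𝓘(ℝ, E) x x))
    {f : M → ℝ} (hf : MDifferentiableAt 𝓘(ℝ, E) 𝓘(ℝ, ℝ) f x) (hfx : f x ≠ 0) :
    IsLeeCovector (fun z => f z • B z) x
      (η + (f x)⁻¹ • (mvfderiv 𝓘(ℝ, E) f x).toLinearMap) := by
  intro u v w
  rw [extDerivTwo_smul hf hB, h u v w]
  simp only [LinearMap.add_apply, LinearMap.smul_apply, ContinuousLinearMap.coe_coe, smul_eq_mul]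
  field_simp
  ring

/-- The closed form `e^{-α} Ω_g` has Lee covector zero; rescaling it by `e^α` recovers `Ω_g` and
produces a Lee covector for it. -/
lemma Metric.IsLocallyConformalKahler.exists_isLeeCovector {g : Metric E M}
    {J : AlmostComplexStructure E M} (h : g.IsLocallyConformalKahler J) (x : M) :
    ∃ η, IsLeeCovector (g.fundForm J) x η := by
  obtain ⟨U, α, hU, hxU, hα, hclosed⟩ := h x
  have hαx : MDifferentiableAt 𝓘(ℝ, E) 𝓘(ℝ, ℝ) α x :=
    (hα.contMDiffAt (hU.mem_nhds hxU)).mdifferentiableAt (by simp)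
  have hexp : ∀ r : ℝ, MDifferentiableAt 𝓘(ℝ, E) 𝓘(ℝ, ℝ) (fun z => Real.exp (r * α z)) x :=
    fun r => DifferentiableAt.comp_mdifferentiableAt
      (g := fun y : ℝ => Real.exp (r * y)) (by fun_prop) hαx
  have h0 : IsLeeCovector (fun z => Real.exp (-1 * α z) • g.fundForm J z) x 0 := fun u v w => by
    simpa using hclosed x hxU u v w
  have hB : ∀ a b, DifferentiableAt ℝ
      (twoFormCoef (fun z => Real.exp (-1 * α z) • g.fundForm J z) x a b)
      (extChartAt 𝓘(ℝ, E) x x) := fun a b => by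
    rw [twoFormCoef_smul]
    exact (mdifferentiableAt_comp_extChartAt_symm (hexp _)).mul
      (g.differentiableAt_twoFormCoef J x a b)
  have h1 := h0.smul hB (hexp 1) (Real.exp_pos _).ne'
  simp only [smul_smul, ← Real.exp_add] at h1
  exact ⟨_, by simpa using h1⟩

end Manifold

/-! ### Change of gauge, Weyl connection and momentum maps -/

section Manifold

variable {E : Type*} [NormedAddCommGroup E] [NormedSpace ℝ E]
  {M : Type*} [TopologicalSpace M] [ChartedSpace E M] [IsManifold 𝓘(ℝ, E) ∞ M]
  {c : ConformalStructure E M} {J : AlmostComplexStructure E M}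

lemma ConformalStructure.IsGauge.fundForm_apply {g : Metric E M} (hg : c.IsGauge g) (x : M)
    (u v : TangentSpace 𝓘(ℝ, E) x) : c.fundForm J x u v = g.fundForm J x u v • g.scale 2 x :=
  hg x _ _

variable [FiniteDimensional ℝ E]

/-- Any two metrics of a conformal class differ by a smooth nowhere vanishing factor, and the
densities they define differ by the inverse factor. -/
lemma ConformalStructure.IsGauge.exists_factor {g r : Metric E M} (hg : c.IsGauge g)
    (hr : c.IsGauge r) :
    ∃ κ : SmoothFun E M, (∀ x, κ x ≠ 0) ∧ (∀ x, g.scale 2 x = κ x • r.scale 2 x) ∧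
      r.fundForm J = fun x => κ x • g.fundForm J x := by
  -- `κ` is the ratio of `l_g²` to `l_r²`; comparing `g ⊗ l_g² = r ⊗ l_r²` then forces `r = κ g`.
  obtain ⟨κ, hκ⟩ := r.exists_eq_smul_scale ⟨g.scale 2, g.scale_mem 2⟩
  refine ⟨κ, fun x h => g.scale_ne_zero 2 x ?_, hκ, ?_⟩
  · rw [show g.scale 2 x = κ x • r.scale 2 x from hκ x, h, zero_smul]
  · funext x
    ext u v
    refine smul_left_injective ℝ (r.scale_ne_zero 2 x) ?_
    change r.inner x (J.toFun x u) v • r.scale 2 x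
      = (κ x * g.inner x (J.toFun x u) v) • r.scale 2 x
    rw [← hr, hg, show g.scale 2 x = κ x • r.scale 2 x from hκ x, smul_smul, mul_comm]

lemma IsLCKManifold.inner_map_map (hM : IsLCKManifold c J) {g : Metric E M} (hg : c.IsGauge g)
    (x : M) (u v : TangentSpace 𝓘(ℝ, E) x) :
    g.inner x (J.toFun x u) (J.toFun x v) = g.inner x u v := by
  refine smul_left_injective ℝ (g.scale_ne_zero 2 x) ?_
  change _ • g.scale 2 x = _ • g.scale 2 x
  rw [← hg, ← hg, hM.hermitian]

/-- The hypothesis supplies a single locally conformal Kähler metric; the conformal factor carries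
its Lee covector to any other gauge. -/
lemma IsLCKManifold.exists_isLeeCovector (hM : IsLCKManifold c J) {g : Metric E M}
    (hg : c.IsGauge g) (x : M) : ∃ η, IsLeeCovector (g.fundForm J) x η := by
  obtain ⟨g₀, hg₀, hlck⟩ := hM.lck
  obtain ⟨η, hη⟩ := hlck.exists_isLeeCovector x
  obtain ⟨κ, hκ, -, hform⟩ := hg₀.exists_factor (J := J) hg
  rw [hform]
  exact ⟨_, hη.smul (g₀.differentiableAt_twoFormCoef J x)
    (κ.contMDiff.mdifferentiableAt (by simp)) (hκ x)⟩

lemma IsLCKManifold.isLeeCovector_unique (hM : IsLCKManifold c J) {g : Metric E M}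
    (hg : c.IsGauge g) {x : M} {η η' : TangentSpace 𝓘(ℝ, E) x →ₗ[ℝ] ℝ}
    (h : IsLeeCovector (g.fundForm J) x η) (h' : IsLeeCovector (g.fundForm J) x η') : η = η' := by
  refine sub_eq_zero.1 (eq_zero_of_wedge_eq_zero (V := TangentSpace 𝓘(ℝ, E) x)
    (show 4 ≤ Module.finrank ℝ (TangentSpace 𝓘(ℝ, E) x) from hM.dim) (g.form x) (g.form_pos x)
    (J.toFun x).toLinearMap (hM.inner_map_map hg x) _ fun u v w => ?_)
  have := (h u v w).symm.trans (h' u v w)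
  simp only [Metric.fundForm, LinearMap.comp_apply] at this
  simp only [LinearMap.sub_apply]
  linear_combination this

/-- Existence makes the choice defining the Lee form a genuine solution. -/
lemma IsLCKManifold.isLeeCovector_leeForm (hM : IsLCKManifold c J) {g : Metric E M}
    (hg : c.IsGauge g) (x : M) : IsLeeCovector (g.fundForm J) x (g.leeForm J x) :=
  Classical.epsilon_spec (p := IsLeeCovector (g.fundForm J) x) (hM.exists_isLeeCovector hg x)

/-- In the gauge `g`, the canonical Weyl connection on `L²_M` is the twisted differential:
`∇ (f l_g²) = d^{ω_g} f ⊗ l_g²`. -/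
lemma IsLCKManifold.weyl_eq (hM : IsLCKManifold c J) {g : Metric E M} (hg : c.IsGauge g)
    (f : SmoothFun E M) {s : ∀ x : M, DensityAt E 2 x} (hs : ∀ x, s x = f x • g.scale 2 x) (x : M) :
    c.weyl J s x = (g.twistedDiff J f x).smulRight (g.scale 2 x) := by
  have hr : c.IsGauge c.refMetric := Classical.choose_spec c.exists_metric
  obtain ⟨κ, hκ, hscale, hform⟩ := hg.exists_factor (J := J) hr
  have hκx : MDifferentiableAt 𝓘(ℝ, E) 𝓘(ℝ, ℝ) κ x := κ.contMDiff.mdifferentiableAt (by simp)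
  have hfx : MDifferentiableAt 𝓘(ℝ, E) 𝓘(ℝ, ℝ) f x := f.contMDiff.mdifferentiableAt (by simp)
  have hlee := (hM.isLeeCovector_leeForm hg x).smul (g.differentiableAt_twoFormCoef J x) hκx (hκ x)
  rw [← hform] at hlee
  -- By uniqueness, `ω_r = ω_g + dκ/κ` for the reference metric `r`.
  have hlee' := hM.isLeeCovector_unique hr (hM.isLeeCovector_leeForm hr x) hlee
  have hratio : (fun y => densityRatio (s y) (c.refMetric.scale 2 y)) = fun y => f y * κ y := by
    funext y
    rw [hs, hscale, smul_smul, densityRatio_smul _ (c.refMetric.scale_ne_zero 2 y)]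
  have hratio' : densityRatio (s x) (c.refMetric.scale 2 x) = f x * κ x := congrFun hratio x
  ext1 v
  simp only [ConformalStructure.weyl, hratio, hratio', hlee', Metric.twistedDiff, hscale x,
    mvfderiv_fun_mul hfx hκx, LinearMap.smulRight_apply, smul_smul]
  congr 1
  simp only [LinearMap.sub_apply, LinearMap.smul_apply, LinearMap.add_apply, add_apply,
    smul_apply, ContinuousLinearMap.coe_coe, smul_eq_mul]
  -- For weight two the factor `t / 2` is one, and the identity is `d(fκ) - fκ (ω_g + dκ/κ) = κ (df
  -- - f ω_g)`.
  field_simp [hκ x]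
  ring

/-- In the gauge `g`, the Poisson bracket of `Γ(L²_M)` is the twisted Poisson bracket. -/
lemma IsLCKManifold.poisson_eq (hM : IsLCKManifold c J) {g : Metric E M} (hg : c.IsGauge g)
    (f₁ f₂ : SmoothFun E M) {s₁ s₂ : ∀ x : M, DensityAt E 2 x}
    (h₁ : ∀ x, s₁ x = f₁ x • g.scale 2 x) (h₂ : ∀ x, s₂ x = f₂ x • g.scale 2 x) (x : M) :
    c.poisson J s₁ s₂ x = g.poisson J f₁ f₂ x • g.scale 2 x := by
  have hsharp := sharp_smulRight (g.scale_ne_zero 2 x) (g.fundForm J x) (c.fundForm J x)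
    (hg.fundForm_apply x)
  rw [ConformalStructure.poisson, hM.weyl_eq hg f₁ h₁, hM.weyl_eq hg f₂ h₂, hsharp, hsharp,
    hg.fundForm_apply]
  rfl

variable {EG : Type*} [NormedAddCommGroup EG] [NormedSpace ℝ EG]
  {G : Type*} [TopologicalSpace G] [ChartedSpace EG G] [Group G]

/-- `μ` can be written in a unique way as `ν ⊗ l_g²`. -/
lemma existsUnique_isGaugeForm (g : Metric E M)
    (μ : GroupLieAlgebra 𝓘(ℝ, EG) G → DensitySection E M 2) :
    ∃! ν : GroupLieAlgebra 𝓘(ℝ, EG) G → SmoothFun E M, IsGaugeForm g μ ν := by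
  choose ν hν using fun X => g.exists_eq_smul_scale (μ X)
  refine ⟨ν, hν, fun ν' hν' => funext fun X => ?_⟩
  ext x
  exact smul_left_injective ℝ (g.scale_ne_zero 2 x) ((hν' X x).symm.trans (hν X x))

/-- Multiplication by `l_g²` is linear and injective on each fibre. -/
lemma IsGaugeForm.isLinearMap_iff {g : Metric E M}
    {μ : GroupLieAlgebra 𝓘(ℝ, EG) G → DensitySection E M 2}
    {ν : GroupLieAlgebra 𝓘(ℝ, EG) G → SmoothFun E M} (hν : IsGaugeForm g μ ν) :
    IsLinearMap ℝ μ ↔ IsLinearMap ℝ ν := by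
  have hinj := fun x => smul_left_injective ℝ (g.scale_ne_zero 2 x)
  constructor <;> intro h
  · constructor
    · intro X Y
      ext x
      refine hinj x ?_
      change ν (X + Y) x • g.scale 2 x = (ν X x + ν Y x) • g.scale 2 x
      rw [add_smul, ← hν, ← hν, ← hν, h.map_add]
      rfl
    · intro r X
      ext x
      refine hinj x ?_
      change ν (r • X) x • g.scale 2 x = (r * ν X x) • g.scale 2 x
      rw [mul_smul, ← hν, ← hν, h.map_smul]
      rfl
  · constructor
    · intro X Y
      refine Subtype.ext (funext fun x => ?_)
      change (μ (X + Y)).1 x = (μ X).1 x + (μ Y).1 x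
      rw [hν, hν, hν, ← add_smul, h.map_add]
      rfl
    · intro r X
      refine Subtype.ext (funext fun x => ?_)
      change (μ (r • X)).1 x = r • (μ X).1 x
      rw [hν, hν, smul_smul, h.map_smul]
      rfl

/-- `μ = ν ⊗ l_g²` is a momentum map for the conformal structure if and only if `ν` is a twisted
Hamiltonian momentum map with respect to `g`. -/
lemma isConformalMomentumMap_iff [MulAction G M] (hM : IsLCKManifold c J) {g : Metric E M}
    (hg : c.IsGauge g) {μ : GroupLieAlgebra 𝓘(ℝ, EG) G → DensitySection E M 2}
    {ν : GroupLieAlgebra 𝓘(ℝ, EG) G → SmoothFun E M} (hν : IsGaugeForm g μ ν) :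
    IsConformalMomentumMap c J μ ↔ IsTwistedMomentumMap g J ν := by
  have hinj := fun x => smul_left_injective ℝ (g.scale_ne_zero 2 x)
  have hlie : ∀ X Y x, (μ ⁅X, Y⁆).1 x = c.poisson J (μ X).1 (μ Y).1 x
      ↔ ν ⁅X, Y⁆ x = g.poisson J (ν X) (ν Y) x := fun X Y x => by
    rw [hν, hM.poisson_eq hg (ν X) (ν Y) (hν X) (hν Y)]
    exact (hinj x).eq_iff
  have hcontr : ∀ (X : GroupLieAlgebra 𝓘(ℝ, EG) G) (x : M),
      c.fundForm J x (fundField X x) = c.weyl J (μ X).1 x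
        ↔ g.fundForm J x (fundField X x) = g.twistedDiff J (ν X) x := fun X x => by
    rw [hM.weyl_eq hg (ν X) (hν X), LinearMap.ext_iff, LinearMap.ext_iff]
    refine forall_congr' fun v => ?_
    rw [hg.fundForm_apply, LinearMap.smulRight_apply]
    exact (hinj x).eq_iff
  constructor
  · rintro ⟨h1, h2, h3⟩
    exact ⟨hν.isLinearMap_iff.1 h1, fun X Y x => (hlie X Y x).1 (h2 X Y x),
      fun X x => (hcontr X x).1 (h3 X x)⟩
  · rintro ⟨h1, h2, h3⟩
    exact ⟨hν.isLinearMap_iff.2 h1, fun X Y x => (hlie X Y x).2 (h2 X Y x),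
      fun X x => (hcontr X x).2 (h3 X x)⟩

end Manifold

end LCK

theorem mainTheorem6
    {E : Type*} [NormedAddCommGroup E] [NormedSpace ℝ E] [FiniteDimensional ℝ E]
    {M : Type*} [TopologicalSpace M] [ChartedSpace E M] [IsManifold 𝓘(ℝ, E) ∞ M]
    [T2Space M] [SecondCountableTopology M]
    (c : LCK.ConformalStructure E M) (J : LCK.AlmostComplexStructure E M)
    (hM : LCK.IsLCKManifold c J)
    {EG : Type*} [NormedAddCommGroup EG] [NormedSpace ℝ EG] [FiniteDimensional ℝ EG]
    {G : Type*} [TopologicalSpace G] [ChartedSpace EG G] [Group G] [LieGroup 𝓘(ℝ, EG) ∞ G]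
    [MulAction G M] [ContMDiffSMul 𝓘(ℝ, EG) 𝓘(ℝ, E) ∞ G M]
    (hG : ∀ a : G, LCK.IsAutomorphism c J (Diffeomorph.smul 𝓘(ℝ, EG) 𝓘(ℝ, E) ∞ a))
    (μ : GroupLieAlgebra 𝓘(ℝ, EG) G → LCK.DensitySection E M 2) :
    (∀ g : LCK.Metric E M, c.IsGauge g →
      ∃! ν : GroupLieAlgebra 𝓘(ℝ, EG) G → LCK.SmoothFun E M, LCK.IsGaugeForm g μ ν) ∧
    (∀ g : LCK.Metric E M, c.IsGauge g →
      ∀ ν : GroupLieAlgebra 𝓘(ℝ, EG) G → LCK.SmoothFun E M, LCK.IsGaugeForm g μ ν →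
        (LCK.IsConformalMomentumMap c J μ ↔ LCK.IsTwistedMomentumMap g J ν)) ∧
    (LCK.IsConformalMomentumMap c J μ ↔
      ∃ g : LCK.Metric E M, c.IsGauge g ∧
        ∃ ν : GroupLieAlgebra 𝓘(ℝ, EG) G → LCK.SmoothFun E M,
          LCK.IsGaugeForm g μ ν ∧ LCK.IsTwistedMomentumMap g J ν) := by
  have hgauge : ∀ g : LCK.Metric E M, c.IsGauge g → ∀ ν : GroupLieAlgebra 𝓘(ℝ, EG) G →
      LCK.SmoothFun E M, LCK.IsGaugeForm g μ ν →
      (LCK.IsConformalMomentumMap c J μ ↔ LCK.IsTwistedMomentumMap g J ν) :=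
    fun g hg ν hν => LCK.isConformalMomentumMap_iff hM hg hν
  have href : c.IsGauge c.refMetric := Classical.choose_spec c.exists_metric
  refine ⟨fun g _ => LCK.existsUnique_isGaugeForm g μ, hgauge, fun h => ?_, ?_⟩
  -- The class is nonempty by definition, so its reference metric serves as the witness.
  · obtain ⟨ν, hν, -⟩ := LCK.existsUnique_isGaugeForm c.refMetric μ
    exact ⟨_, href, ν, hν, (hgauge _ href ν hν).1 h⟩
  · rintro ⟨g, hg, ν, hν, h⟩
    exact (hgauge g hg ν hν).2 h
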